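/- For $a,b>0$ and $|x|<1$ let $F(x)=F(a,b;a+b;x)=\sum_{n\ge 0}\frac{(a)_n(b)_n}{(a+b)_n}\frac{x^n}{n!}$, where $(s)_n=s(s+1)\cdots(s+n-1)$ and $(s)_0=1$, be the zero-balanced Gaussian hypergeometric function. Let $B(a,b)=\Gamma(a)\Gamma(b)/\Gamma(a+b)$ and $R(a,b)=-\psi(a)-\psi(b)-2\gamma$, where $\psi=\Gamma'/\Gamma$ and $\gamma$ is the Euler–Mascheroni constant. Put $$D_5=\{(a,b): a,b>0,\ a+b\le 1,\ ab\le\tfrac29(a+b)\},\qquad D_6=\{(a,b): a,b>0,\ a+b\ge 1,\ ab\ge\tfrac29(a+b)\}.$$ **Theorem 2.4.** If $(a,b)\in D_5$, then for all $r\in(0,1)$ $$0\le(1+2r)F(r^3)-F\!\left(\frac{9r(1+r+r^2)}{(1+2r)^3}\right)\le\frac{2\,(R(a,b)-\log 27)}{B(a,b)}.$$ If $(a,b)\in D_6$, then for all $r\in(0,1)$ $$0\le F\!\left(\frac{9r(1+r+r^2)}{(1+2r)^3}\right)-(1+2r)F(r^3)\le\frac{2\,(\log 27-R(a,b))}{B(a,b)}.$$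 -/

import Mathlib

/-- The zero-balanced Gaussian hypergeometric function `F(a, b; a + b; x)` of real arguments
(for `a, b > 0` its series converges for `|x| < 1`). -/
noncomputable def zeroBalancedF (a b x : ℝ) : ℝ :=
  ordinaryHypergeometric a b (a + b) x

/-- The digamma function `ψ(x) = Γ'(x) / Γ(x)` of a real argument `x > 0`. -/
noncomputable def realDigamma (x : ℝ) : ℝ :=
  deriv Real.Gamma x / Real.Gamma x

/-- The Ramanujan constant `R(a, b) = -ψ(a) - ψ(b) - 2γ`. -/
noncomputable def ramanujanR (a b : ℝ) : ℝ :=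
  -realDigamma a - realDigamma b - 2 * Real.eulerMascheroniConstant

/-- The region `a, b > 0`, `a + b ≤ 1`, `ab ≤ (2/9)(a + b)`. -/
def regionD5 : Set (ℝ × ℝ) :=
  {p | 0 < p.1 ∧ 0 < p.2 ∧ p.1 + p.2 ≤ 1 ∧ p.1 * p.2 - 2 / 9 * (p.1 + p.2) ≤ 0}

/-- The region `a, b > 0`, `a + b ≥ 1`, `ab ≥ (2/9)(a + b)`. -/
def regionD6 : Set (ℝ × ℝ) :=
  {p | 0 < p.1 ∧ 0 < p.2 ∧ 1 ≤ p.1 + p.2 ∧ 0 ≤ p.1 * p.2 - 2 / 9 * (p.1 + p.2)}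

/-! Write `H = F(1/3, 2/3; 1; ·)`, let `X(r)` be the transformed argument, and let `D(r) = (1 + 2r)
F(r³) - F(X(r))`. For `F = H`, Ramanujan's cubic transformation says `D = 0`
(`cubic_transformation`). For general `a, b`, differentiating that identity removes the stray terms
from `H'(r³) D'(r)`. What is left is a Wronskian of `F` and `H` at `r³`, plus a positive multiple of
a comparison of `F'/H'` at `r³ ≤ X(r)` (`deriv_cubicDefect_mul`). Both have a sign as soon as the
coefficient ratio of `F` to `H` is monotone, which the two regions guarantee. So `D` is monotone and
lies between `D(0) = 0` and its limit at `1`.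

The limit comes from `B(a, b) F(x) + log (1 - x) → R(a, b)`. By Abel's theorem this reduces to
evaluating `∑ (gammaCoeff a b n - 1 / (n + 1))`. As a function of `a`, that sum is antitone and
obeys the recurrence of `-ψ`, so monotonicity forces it to be `-ψ(a)` up to a constant; symmetry and
the value at `(1, 1)` fix the constant. -/

open Filter Topology

/-! ### Termwise differentiation of power series -/

/-- The sum of the real power series with coefficients `c`. -/
noncomputable def powSum (c : ℕ → ℝ) (x : ℝ) : ℝ := ∑' n, c n * x ^ n

/-- The coefficients of the derivative of a power series. -/
def derivCoeff (c : ℕ → ℝ) (n : ℕ) : ℝ := (n + 1) * c (n + 1)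

/-- The power series with coefficients `c` converges on the open unit interval. -/
def ConvOnUnit (c : ℕ → ℝ) : Prop := ∀ x : ℝ, |x| < 1 → Summable fun n => c n * x ^ n

protected theorem ConvOnUnit.derivCoeff {c : ℕ → ℝ} (hc : ConvOnUnit c) :
    ConvOnUnit (_root_.derivCoeff c) := by
  intro x hx
  obtain ⟨ρ, h1, h2⟩ := exists_between hx
  have hρ : 0 < ρ := (abs_nonneg x).trans_lt h1
  obtain ⟨M, hM⟩ := (hc ρ (by rwa [abs_of_pos hρ])).tendsto_atTop_zero.abs.bddAbove_range
  have hq : ‖|x| / ρ‖ < 1 := by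
    rw [Real.norm_of_nonneg (by positivity), div_lt_one hρ]; exact h1
  have hs : Summable fun n : ℕ => (M / ρ) * (((n : ℝ) ^ 1 + 1) * (|x| / ρ) ^ n) := by
    refine Summable.mul_left _ ?_
    simp_rw [add_mul, one_mul]
    exact (summable_pow_mul_geometric_of_norm_lt_one 1 hq).add
      (summable_geometric_of_norm_lt_one hq)
  refine Summable.of_norm_bounded hs fun n => ?_
  have h3 : |c (n + 1)| * ρ ^ (n + 1) ≤ M := by
    have := hM ⟨n + 1, rfl⟩
    simpa [abs_mul, abs_of_pos hρ] using this
  have h4 : |c (n + 1)| ≤ M / ρ ^ (n + 1) := by rwa [le_div_iff₀ (by positivity)]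
  rw [_root_.derivCoeff, Real.norm_eq_abs, abs_mul, abs_mul, abs_pow,
    abs_of_nonneg (by positivity : (0 : ℝ) ≤ n + 1)]
  calc ((n : ℝ) + 1) * |c (n + 1)| * |x| ^ n ≤ (n + 1) * (M / ρ ^ (n + 1)) * |x| ^ n := by gcongr
    _ = _ := by rw [div_pow, pow_succ]; field_simp

theorem ConvOnUnit.hasDerivAt {c : ℕ → ℝ} (hc : ConvOnUnit c) {x : ℝ} (hx : |x| < 1) :
    HasDerivAt (powSum c) (powSum (derivCoeff c) x) x := by
  obtain ⟨ρ, h1, h2⟩ := exists_between hx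
  have hρ : 0 < ρ := (abs_nonneg x).trans_lt h1
  have hu : Summable fun n : ℕ => |c n * (n * ρ ^ (n - 1))| := by
    rw [← summable_nat_add_iff 1]
    refine (hc.derivCoeff ρ (by rwa [abs_of_pos hρ])).abs.congr fun n => ?_
    simp only [_root_.derivCoeff, Nat.add_sub_cancel]
    push_cast
    congr 1; ring
  have key := hasDerivAt_tsum_of_isPreconnected (g := fun n y => c n * y ^ n)
    (g' := fun n y => c n * (n * y ^ (n - 1))) (t := Set.Ioo (-ρ) ρ) (y₀ := 0) (y := x) hu
    isOpen_Ioo isPreconnected_Ioo (fun n y _ => (hasDerivAt_pow n y).const_mul (c n)) ?_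
    ⟨by linarith, hρ⟩ (hc 0 (by simp)) (abs_lt.mp h1)
  · have h5 : Summable fun n : ℕ => c n * (n * x ^ (n - 1)) := by
      refine Summable.of_norm_bounded hu fun n => ?_
      rw [Real.norm_eq_abs, abs_mul, abs_mul, abs_mul, abs_mul, abs_pow, abs_pow, abs_of_pos hρ]
      gcongr
    have h6 : ∑' n : ℕ, c n * (n * x ^ (n - 1)) = powSum (_root_.derivCoeff c) x := by
      rw [h5.tsum_eq_zero_add, powSum]
      simp only [CharP.cast_eq_zero, zero_mul, mul_zero, zero_add, Nat.add_sub_cancel,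
        _root_.derivCoeff]
      refine tsum_congr fun n => ?_
      push_cast; ring
    rw [← h6]
    exact key
  · intro n y hy
    have hy' : |y| ≤ |ρ| := by rw [abs_of_pos hρ]; exact (abs_lt.mpr hy).le
    rw [Real.norm_eq_abs, abs_mul, abs_mul, abs_mul, abs_mul, abs_pow, abs_pow]
    gcongr

theorem ConvOnUnit.hasSum_natCast_mul {c : ℕ → ℝ} (hc : ConvOnUnit c) {x : ℝ} (hx : |x| < 1) :
    HasSum (fun n => c n * (n * x ^ n)) (x * powSum (derivCoeff c) x) := by
  rw [← hasSum_nat_add_iff' 1]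
  simp only [Finset.sum_range_one, CharP.cast_eq_zero, zero_mul, mul_zero, sub_zero]
  refine ((hc.derivCoeff x hx).hasSum.mul_left x).congr_fun ?_
  intro n
  simp only [_root_.derivCoeff]; push_cast; ring

theorem powSum_zero (c : ℕ → ℝ) : powSum c 0 = c 0 := by
  rw [powSum, tsum_eq_single 0]
  · simp
  · intro n hn; simp [hn]

theorem ConvOnUnit.powSum_pos {c : ℕ → ℝ} (hc : ConvOnUnit c) (h : ∀ n, 0 < c n) {x : ℝ}
    (hx0 : 0 ≤ x) (hx : x < 1) : 0 < powSum c x :=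
  (hc x (by rwa [abs_of_nonneg hx0])).tsum_pos
    (fun n => mul_nonneg (h n).le (pow_nonneg hx0 n)) 0 (by simpa using h 0)

/-! ### Monotone coefficient ratios -/

/-- A Chebyshev-type inequality for two pairs of sequences with monotone ratios. -/
theorem tsum_mul_tsum_le_of_ratio {A B p q : ℕ → ℝ}
    (hAp : Summable fun n => A n * p n) (hAq : Summable fun n => A n * q n)
    (hBp : Summable fun n => B n * p n) (hBq : Summable fun n => B n * q n)
    (hAB : ∀ m n, m ≤ n → A n * B m ≤ A m * B n)
    (hpq : ∀ m n, m ≤ n → p n * q m ≤ p m * q n) :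
    (∑' n, A n * q n) * (∑' n, B n * p n) ≤ (∑' n, A n * p n) * (∑' n, B n * q n) := by
  have s1 := summable_mul_of_summable_norm hAp.norm hBq.norm
  have s2 := summable_mul_of_summable_norm hAq.norm hBp.norm
  rw [hAp.tsum_mul_tsum hBq s1, hAq.tsum_mul_tsum hBp s2, ← sub_nonneg, ← s1.tsum_sub s2]
  set f : ℕ × ℕ → ℝ := fun z => A z.1 * p z.1 * (B z.2 * q z.2) - A z.1 * q z.1 * (B z.2 * p z.2)
    with hf
  have s3 : Summable f := s1.sub s2
  have e : ∑' z, f z = ∑' z, f (Prod.swap z) := ((Equiv.prodComm ℕ ℕ).tsum_eq f).symm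
  have s4 : Summable fun z => f (Prod.swap z) := (Equiv.prodComm ℕ ℕ).summable_iff.mpr s3
  -- The double series `f` has no sign termwise, but its symmetrization is a product of two
  -- differences of equal sign.
  have h : 0 ≤ ∑' z, (f z + f (Prod.swap z)) := by
    refine tsum_nonneg fun z => ?_
    obtain ⟨m, n⟩ := z
    have : f (m, n) + f (Prod.swap (m, n)) =
        (A m * B n - A n * B m) * (p m * q n - p n * q m) := by simp only [hf, Prod.swap]; ring
    rw [this]
    rcases le_total m n with h | h
    · exact mul_nonneg (sub_nonneg.mpr (hAB m n h)) (sub_nonneg.mpr (hpq m n h))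
    · exact mul_nonneg_of_nonpos_of_nonpos (sub_nonpos.mpr (hAB n m h))
        (sub_nonpos.mpr (hpq n m h))
  rw [s3.tsum_add s4, ← e] at h
  linarith

theorem ratio_le_of_succ {A B : ℕ → ℝ} (hB : ∀ n, 0 < B n)
    (h : ∀ n, A (n + 1) * B n ≤ A n * B (n + 1)) (m n : ℕ) (hmn : m ≤ n) :
    A n * B m ≤ A m * B n := by
  have : Antitone fun n => A n / B n := antitone_nat_of_succ_le fun n => by
    rw [div_le_div_iff₀ (hB _) (hB _)]; exact h n
  have := this hmn
  rwa [div_le_div_iff₀ (hB _) (hB _)] at this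

/-- The factor `(m + 1)(n + 1)` is common to both sides, so derivatives inherit a monotone ratio. -/
theorem ratio_derivCoeff {A B : ℕ → ℝ} (h : ∀ m n, m ≤ n → A n * B m ≤ A m * B n)
    (m n : ℕ) (hmn : m ≤ n) :
    derivCoeff A n * derivCoeff B m ≤ derivCoeff A m * derivCoeff B n := by
  have := h (m + 1) (n + 1) (by omega)
  simp only [derivCoeff]
  have h2 : (0 : ℝ) ≤ ((n : ℝ) + 1) * (m + 1) := by positivity
  nlinarith [mul_le_mul_of_nonneg_left this h2]

/-- If the ratio of coefficients `A / B` decreases, so does the ratio of the sums. -/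
theorem powSum_ratio_le {A B : ℕ → ℝ} (hA : ConvOnUnit A) (hB : ConvOnUnit B)
    (h : ∀ m n, m ≤ n → A n * B m ≤ A m * B n) {x y : ℝ} (hx : 0 ≤ x) (hxy : x ≤ y)
    (hy : y < 1) : powSum A y * powSum B x ≤ powSum A x * powSum B y := by
  have hx1 : |x| < 1 := by rw [abs_of_nonneg hx]; linarith
  have hy1 : |y| < 1 := by rw [abs_of_nonneg (hx.trans hxy)]; linarith
  refine tsum_mul_tsum_le_of_ratio (hA x hx1) (hA y hy1) (hB x hx1) (hB y hy1) h ?_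
  intro m n hmn
  obtain ⟨k, rfl⟩ := Nat.exists_eq_add_of_le hmn
  have : x ^ k ≤ y ^ k := by gcongr
  have h0 : 0 ≤ x ^ m * y ^ m := mul_nonneg (pow_nonneg hx _) (pow_nonneg (hx.trans hxy) _)
  rw [pow_add, pow_add]
  nlinarith [mul_le_mul_of_nonneg_left this h0]

/-- If the ratio of coefficients `A / B` decreases, the Wronskian of the sums has a sign. -/
theorem powSum_derivCoeff_mul_le {A B : ℕ → ℝ} (hA : ConvOnUnit A) (hB : ConvOnUnit B)
    (h : ∀ m n, m ≤ n → A n * B m ≤ A m * B n) {y : ℝ} (hy0 : 0 < y) (hy : y < 1) :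
    powSum (derivCoeff A) y * powSum B y ≤ powSum A y * powSum (derivCoeff B) y := by
  have hy1 : |y| < 1 := by rwa [abs_of_pos hy0]
  -- With weights `y ^ n` and `n y ^ n` the Chebyshev inequality compares sums with their images
  -- under `y d/dy`; the spare factor `y > 0` then cancels.
  have key := tsum_mul_tsum_le_of_ratio (p := fun n => y ^ n) (q := fun n => n * y ^ n)
    (hA y hy1) (hA.hasSum_natCast_mul hy1).summable (hB y hy1) (hB.hasSum_natCast_mul hy1).summable h ?_
  · rw [(hA.hasSum_natCast_mul hy1).tsum_eq, (hB.hasSum_natCast_mul hy1).tsum_eq] at key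
    change y * powSum (derivCoeff A) y * powSum B y ≤
      powSum A y * (y * powSum (derivCoeff B) y) at key
    nlinarith
  · intro m n hmn
    have : (m : ℝ) ≤ n := by exact_mod_cast hmn
    have h0 : 0 ≤ y ^ n * y ^ m := by positivity
    nlinarith [mul_le_mul_of_nonneg_left this h0]

/-! ### Hypergeometric coefficients and the equation for `H` -/

/-- The coefficients of the zero-balanced hypergeometric series. -/
noncomputable def hypCoeff (a b : ℝ) (n : ℕ) : ℝ := ordinaryHypergeometricCoefficient a b (a + b) n

theorem zeroBalancedF_eq_powSum (a b x : ℝ) : zeroBalancedF a b x = powSum (hypCoeff a b) x := by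
  rw [zeroBalancedF, ordinaryHypergeometric_eq_tsum]
  rfl

theorem hypCoeff_zero (a b : ℝ) : hypCoeff a b 0 = 1 := by
  simp [hypCoeff, ordinaryHypergeometricCoefficient]

theorem hypCoeff_pos {a b : ℝ} (ha : 0 < a) (hb : 0 < b) (n : ℕ) : 0 < hypCoeff a b n := by
  have h1 := ascPochhammer_pos n a ha
  have h2 := ascPochhammer_pos n b hb
  have h3 := ascPochhammer_pos n (a + b) (by positivity)
  rw [hypCoeff, ordinaryHypergeometricCoefficient]
  positivity

theorem hypCoeff_succ {a b : ℝ} (ha : 0 < a) (hb : 0 < b) (n : ℕ) :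
    hypCoeff a b (n + 1) = hypCoeff a b n * ((a + n) * (b + n) / ((a + b + n) * (n + 1))) := by
  have h3 := ascPochhammer_pos n (a + b) (by positivity)
  have h4 : (0 : ℝ) < a + b + n := by positivity
  have h5 : (0 : ℝ) < (n.factorial : ℝ) := by positivity
  simp only [hypCoeff, ordinaryHypergeometricCoefficient, ascPochhammer_succ_eval,
    Nat.factorial_succ]
  push_cast
  field_simp

theorem convOnUnit_hypCoeff {a b : ℝ} (ha : 0 < a) (hb : 0 < b) : ConvOnUnit (hypCoeff a b) := by
  intro x hx
  have hr : (ordinaryHypergeometricSeries ℝ a b (a + b)).radius = 1 := by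
    refine ordinaryHypergeometricSeries_radius_eq_one ℝ a b (a + b) fun n => ?_
    have : (0 : ℝ) ≤ n := n.cast_nonneg
    refine ⟨?_, ?_, ?_⟩ <;> intro h <;> linarith
  have := (ordinaryHypergeometricSeries ℝ a b (a + b)).summable (x := x)
    (by rw [hr]; simpa [← ofReal_norm, enorm_eq_nnnorm, ← NNReal.coe_lt_coe] using hx)
  exact this.congr fun n => ordinaryHypergeometricSeries_apply_eq a b (a + b) x n

/-- Coefficientwise this is the recurrence of the series: `(n + 1)² c (n + 1) = (n + 1/3)(n + 2/3) c
n`, with `(1/3)(2/3) = 2/9`. -/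
theorem hypergeometric_ode_third {x : ℝ} (hx : |x| < 1) :
    x * (1 - x) * powSum (derivCoeff (derivCoeff (hypCoeff (1 / 3) (2 / 3)))) x
      + (1 - 2 * x) * powSum (derivCoeff (hypCoeff (1 / 3) (2 / 3))) x
      = 2 / 9 * powSum (hypCoeff (1 / 3) (2 / 3)) x := by
  set B := hypCoeff (1 / 3) (2 / 3) with hB
  have hc : ConvOnUnit B := convOnUnit_hypCoeff (by norm_num) (by norm_num)
  have h1 := hc.derivCoeff.hasSum_natCast_mul hx
  have h2 := (hc.derivCoeff x hx).hasSum
  have h3 := hc.hasSum_natCast_mul hx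
  have h4 : HasSum (fun n : ℕ => B n * (n * (n - 1) * x ^ n))
      (x * (x * powSum (derivCoeff (derivCoeff B)) x)) := by
    rw [← hasSum_nat_add_iff' 1]
    simp only [Finset.sum_range_one, CharP.cast_eq_zero, zero_mul, mul_zero, sub_zero]
    refine (h1.mul_left x).congr_fun fun n => ?_
    simp only [derivCoeff]; push_cast; ring
  have h5 := (hc x hx).hasSum.mul_left (2 / 9)
  have h6 := ((h1.add h2).sub h4).sub (h3.mul_left 2)
  have h7 := h6.unique (h5.congr_fun fun n => ?_)
  · change _ - 2 * _ = 2 / 9 * powSum B x at h7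
    rw [← h7]
    change _ = x * powSum (derivCoeff (derivCoeff B)) x + powSum (derivCoeff B) x - _ - _
    ring
  · have : B (n + 1) = B n * ((1 / 3 + n) * (2 / 3 + n) / ((1 + n) * (n + 1))) := by
      rw [hB, hypCoeff_succ (by norm_num) (by norm_num)]; norm_num
    simp only [derivCoeff, this]
    field_simp
    ring

/-- The function `z (1 - z) H'(z)` for `H = F(1/3, 2/3; 1; ·)`. -/
theorem hasDerivAt_selfAdjoint_third {x : ℝ} (hx : |x| < 1) :
    HasDerivAt (fun z => z * (1 - z) * powSum (derivCoeff (hypCoeff (1 / 3) (2 / 3))) z)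
      (2 / 9 * powSum (hypCoeff (1 / 3) (2 / 3)) x) x := by
  have hc : ConvOnUnit (hypCoeff (1 / 3) (2 / 3)) :=
    convOnUnit_hypCoeff (by norm_num) (by norm_num)
  have h1 : HasDerivAt (fun z : ℝ => z * (1 - z)) (1 - 2 * x) x := by
    convert! (hasDerivAt_id x).mul ((hasDerivAt_id x).const_sub 1) using 1
    simp; ring
  convert! h1.mul (hc.derivCoeff.hasDerivAt hx) using 1
  rw [← hypergeometric_ode_third hx]; ring

/-! ### The cubic modulus -/

/-- The modulus `9 r (1 + r + r ^ 2) / (1 + 2 r) ^ 3` of the cubic transformation. -/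
noncomputable def cubicModulus (r : ℝ) : ℝ := 9 * r * (1 + r + r ^ 2) / (1 + 2 * r) ^ 3

theorem one_sub_cubicModulus {r : ℝ} (hr : 0 ≤ r) :
    1 - cubicModulus r = ((1 - r) / (1 + 2 * r)) ^ 3 := by
  have : 1 + 2 * r ≠ 0 := by positivity
  rw [cubicModulus]; field_simp; ring

theorem cubicModulus_nonneg {r : ℝ} (hr : 0 ≤ r) : 0 ≤ cubicModulus r := by
  rw [cubicModulus]; positivity

theorem cubicModulus_lt_one {r : ℝ} (hr : 0 ≤ r) (hr1 : r < 1) : cubicModulus r < 1 := by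
  have h := one_sub_cubicModulus hr
  have : 0 < ((1 - r) / (1 + 2 * r)) ^ 3 := pow_pos (div_pos (by linarith) (by positivity)) 3
  linarith

theorem abs_cubicModulus_lt_one {r : ℝ} (hr : 0 ≤ r) (hr1 : r < 1) : |cubicModulus r| < 1 := by
  rw [abs_of_nonneg (cubicModulus_nonneg hr)]; exact cubicModulus_lt_one hr hr1

theorem abs_cube_lt_one {r : ℝ} (hr : 0 ≤ r) (hr1 : r < 1) : |r ^ 3| < 1 := by
  rw [abs_of_nonneg (by positivity)]; exact pow_lt_one₀ hr hr1 (by norm_num)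

/-- `1 - X = ((1 - r)/(1 + 2r))³ ≤ (1 - r)³ ≤ 1 - r³`. -/
theorem cube_le_cubicModulus {r : ℝ} (hr : 0 ≤ r) (hr1 : r < 1) : r ^ 3 ≤ cubicModulus r := by
  have h := one_sub_cubicModulus hr
  have h1 : ((1 - r) / (1 + 2 * r)) ^ 3 ≤ (1 - r) ^ 3 := by
    have : (1 - r) / (1 + 2 * r) ≤ 1 - r := div_le_self (by linarith) (by linarith)
    have h0 : 0 ≤ (1 - r) / (1 + 2 * r) := div_nonneg (by linarith) (by linarith)
    gcongr
  nlinarith [mul_nonneg hr (sub_nonneg.mpr hr1.le)]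

theorem hasDerivAt_cubicModulus {r : ℝ} (hr : 0 ≤ r) :
    HasDerivAt cubicModulus (9 * (1 - r) ^ 2 / (1 + 2 * r) ^ 4) r := by
  have h0 : 1 + 2 * r ≠ 0 := by positivity
  have hm : HasDerivAt (fun r : ℝ => 1 + 2 * r) 2 r := by
    simpa using ((hasDerivAt_id r).const_mul 2).const_add 1
  have hn : HasDerivAt (fun r : ℝ => 9 * r * (1 + r + r ^ 2)) (9 + 18 * r + 27 * r ^ 2) r := by
    convert! ((hasDerivAt_id r).const_mul 9).mul
      (((hasDerivAt_id r).const_add 1).add (hasDerivAt_pow 2 r)) using 1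
    simp; ring
  convert! hn.div (hm.pow 3) (pow_ne_zero 3 h0) using 1
  simp; field_simp; ring

theorem hasDerivAt_powSum_cubicModulus {c : ℕ → ℝ} (hc : ConvOnUnit c) {r : ℝ} (hr : 0 ≤ r)
    (hr1 : r < 1) : HasDerivAt (fun r => powSum c (cubicModulus r))
      (powSum (derivCoeff c) (cubicModulus r) * (9 * (1 - r) ^ 2 / (1 + 2 * r) ^ 4)) r :=
  (hc.hasDerivAt (abs_cubicModulus_lt_one hr hr1)).comp r (hasDerivAt_cubicModulus hr)

theorem hasDerivAt_cube (r : ℝ) : HasDerivAt (fun r : ℝ => r ^ 3) (3 * r ^ 2) r := by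
  simpa using hasDerivAt_pow 3 r

theorem hasDerivAt_powSum_comp_cube {c : ℕ → ℝ} (hc : ConvOnUnit c) {r : ℝ} (hr : 0 ≤ r)
    (hr1 : r < 1) : HasDerivAt (fun r => powSum c (r ^ 3))
      (powSum (derivCoeff c) (r ^ 3) * (3 * r ^ 2)) r :=
  HasDerivAt.comp (h₂ := powSum c) (h := fun r : ℝ => r ^ 3) r
    (hc.hasDerivAt (abs_cube_lt_one hr hr1)) (hasDerivAt_cube r)

theorem hasDerivAt_powSum_cube {c : ℕ → ℝ} (hc : ConvOnUnit c) {r : ℝ} (hr : 0 ≤ r)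
    (hr1 : r < 1) : HasDerivAt (fun r => (1 + 2 * r) * powSum c (r ^ 3))
      (2 * powSum c (r ^ 3) + (1 + 2 * r) * (powSum (derivCoeff c) (r ^ 3) * (3 * r ^ 2))) r := by
  have hm : HasDerivAt (fun r : ℝ => 1 + 2 * r) 2 r := by
    simpa using ((hasDerivAt_id r).const_mul 2).const_add 1
  exact hm.mul (hasDerivAt_powSum_comp_cube hc hr hr1)

/-- The derivative need vanish only for `r > 0`: the Wronskian weight below vanishes at `0` and
gives no information there. -/
theorem eq_of_hasDerivAt_zero {f f' : ℝ → ℝ} (hf : ∀ r, 0 ≤ r → r < 1 → HasDerivAt f (f' r) r)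
    (h0 : ∀ r, 0 < r → r < 1 → f' r = 0) {r : ℝ} (hr : 0 ≤ r) (hr1 : r < 1) : f r = f 0 := by
  rcases hr.eq_or_lt with rfl | hr0
  · rfl
  obtain ⟨c, hc, h⟩ := exists_hasDerivAt_eq_slope f f' hr0
    (fun x hx => (hf x hx.1 (hx.2.trans_lt hr1)).continuousAt.continuousWithinAt)
    (fun x hx => hf x hx.1.le (hx.2.trans hr1))
  rw [h0 c hc.1 (hc.2.trans hr1), eq_comm, div_eq_zero_iff] at h
  rcases h with h | h <;> linarith

/-! ### Ramanujan's cubic transformation -/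

/-- The weighted Wronskian of the two sides of the cubic transformation vanishes. -/
theorem cubic_wronskian_eq_zero {r : ℝ} (hr : 0 ≤ r) (hr1 : r < 1) :
    powSum (hypCoeff (1 / 3) (2 / 3)) (cubicModulus r) *
      (2 * (r * (1 - r ^ 3)) / (1 + 2 * r) ^ 2 * powSum (hypCoeff (1 / 3) (2 / 3)) (r ^ 3) +
        3 / (1 + 2 * r) *
          (r ^ 3 * (1 - r ^ 3) * powSum (derivCoeff (hypCoeff (1 / 3) (2 / 3))) (r ^ 3))) =
    (1 + 2 * r) * powSum (hypCoeff (1 / 3) (2 / 3)) (r ^ 3) *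
      (cubicModulus r * (1 - cubicModulus r) *
        powSum (derivCoeff (hypCoeff (1 / 3) (2 / 3))) (cubicModulus r)) := by
  set B := hypCoeff (1 / 3) (2 / 3) with hB
  have hc : ConvOnUnit B := convOnUnit_hypCoeff (by norm_num) (by norm_num)
  have hd : ∀ r : ℝ, 0 ≤ r → r < 1 → HasDerivAt (fun r : ℝ => powSum B (cubicModulus r) *
      (2 * (r * (1 - r ^ 3)) / (1 + 2 * r) ^ 2 * powSum B (r ^ 3) +
        3 / (1 + 2 * r) * (r ^ 3 * (1 - r ^ 3) * powSum (derivCoeff B) (r ^ 3))) -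
      (1 + 2 * r) * powSum B (r ^ 3) *
      (cubicModulus r * (1 - cubicModulus r) * powSum (derivCoeff B) (cubicModulus r))) 0 r := by
    intro r hr hr1
    have h0 : 1 + 2 * r ≠ 0 := by positivity
    have hm : HasDerivAt (fun r : ℝ => 1 + 2 * r) 2 r := by
      simpa using ((hasDerivAt_id r).const_mul 2).const_add 1
    have e1 : HasDerivAt (fun r : ℝ => 2 * (r * (1 - r ^ 3)) / (1 + 2 * r) ^ 2)
        ((2 * (1 - 4 * r ^ 3) * (1 + 2 * r) ^ 2 - 2 * (r * (1 - r ^ 3)) * (4 * (1 + 2 * r)))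
          / ((1 + 2 * r) ^ 2) ^ 2) r := by
      have hn : HasDerivAt (fun r : ℝ => 2 * (r * (1 - r ^ 3))) (2 * (1 - 4 * r ^ 3)) r := by
        convert! ((hasDerivAt_id r).mul ((hasDerivAt_cube r).const_sub 1)).const_mul 2 using 1
        simp; ring
      convert! hn.div (hm.pow 2) (pow_ne_zero 2 h0) using 1
      simp; ring
    have e2 : HasDerivAt (fun r : ℝ => 3 / (1 + 2 * r)) (-6 / (1 + 2 * r) ^ 2) r := by
      convert! (hasDerivAt_const r (3 : ℝ)).div hm h0 using 1
      ring
    have e3 : HasDerivAt (fun r : ℝ => powSum B (r ^ 3)) _ r :=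
      hasDerivAt_powSum_comp_cube hc hr hr1
    have e4 : HasDerivAt
        (fun r : ℝ => r ^ 3 * (1 - r ^ 3) * powSum (derivCoeff B) (r ^ 3)) _ r :=
      HasDerivAt.comp (h := fun r : ℝ => r ^ 3) r
        (hasDerivAt_selfAdjoint_third (abs_cube_lt_one hr hr1)) (hasDerivAt_cube r)
    have e5 : HasDerivAt (fun r : ℝ =>
        cubicModulus r * (1 - cubicModulus r) * powSum (derivCoeff B) (cubicModulus r)) _ r :=
      (hasDerivAt_selfAdjoint_third (abs_cubicModulus_lt_one hr hr1)).comp r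
        (hasDerivAt_cubicModulus hr)
    convert! ((hasDerivAt_powSum_cubicModulus hc hr hr1).mul
      ((e1.mul e3).add (e2.mul e4))).sub ((hm.mul e3).mul e5) using 1
    -- The self-adjoint equation has removed second derivatives, so the values of `H` and `H'` at
    -- the two points can be treated as free symbols in a rational identity in `r`.
    simp only [← hB, Pi.mul_apply, Pi.add_apply]
    generalize powSum B (cubicModulus r) = u
    generalize powSum (derivCoeff B) (cubicModulus r) = u1
    generalize powSum B (r ^ 3) = w
    generalize powSum (derivCoeff B) (r ^ 3) = w1
    rw [cubicModulus]
    field_simp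
    ring
  have := eq_of_hasDerivAt_zero hd (fun _ _ _ => rfl) hr hr1
  rw [← sub_eq_zero, this]
  simp [cubicModulus]

/-- Ramanujan's cubic transformation for `F(1/3, 2/3; 1; ·)`. -/
theorem cubic_transformation {r : ℝ} (hr : 0 ≤ r) (hr1 : r < 1) :
    powSum (hypCoeff (1 / 3) (2 / 3)) (cubicModulus r) =
      (1 + 2 * r) * powSum (hypCoeff (1 / 3) (2 / 3)) (r ^ 3) := by
  set B := hypCoeff (1 / 3) (2 / 3) with hB
  have hc : ConvOnUnit B := convOnUnit_hypCoeff (by norm_num) (by norm_num)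
  have hpos : ∀ n, 0 < B n := hypCoeff_pos (by norm_num) (by norm_num)
  have hv : ∀ r : ℝ, 0 ≤ r → r < 1 → 0 < (1 + 2 * r) * powSum B (r ^ 3) := fun r hr hr1 =>
    mul_pos (by positivity)
      (hc.powSum_pos hpos (by positivity) ((le_abs_self _).trans_lt (abs_cube_lt_one hr hr1)))
  have := eq_of_hasDerivAt_zero (fun r hr hr1 => (hasDerivAt_powSum_cubicModulus hc hr hr1).div
    (hasDerivAt_powSum_cube hc hr hr1) (hv r hr hr1).ne') ?_ hr hr1
  · have h0 : cubicModulus 0 = 0 := by simp [cubicModulus]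
    have hB0 : B 0 = 1 := hypCoeff_zero _ _
    simp only [Pi.div_apply, h0] at this
    rw [div_eq_iff (hv r hr hr1).ne'] at this
    rw [this]
    simp [powSum_zero, hB0]
  · intro r hr hr1
    have hW := cubic_wronskian_eq_zero hr.le hr1
    rw [← hB] at hW
    rw [div_eq_zero_iff]
    left
    revert hW
    generalize powSum B (cubicModulus r) = u
    generalize powSum (derivCoeff B) (cubicModulus r) = u1
    generalize powSum B (r ^ 3) = w
    generalize powSum (derivCoeff B) (r ^ 3) = w1
    intro hW
    have h0 : 1 + 2 * r ≠ 0 := by positivity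
    -- This is the Wronskian weight: multiplied by it, the derivatives of the two sides become the
    -- bracketed expressions of `cubic_wronskian_eq_zero`.
    have hP : r * (1 - r ^ 3) / (1 + 2 * r) ^ 2 ≠ 0 := by
      have : r ^ 3 < 1 := pow_lt_one₀ hr.le hr1 (by norm_num)
      exact div_ne_zero (mul_ne_zero hr.ne' (by linarith)) (pow_ne_zero 2 h0)
    apply mul_left_cancel₀ hP
    rw [mul_zero, ← sub_eq_zero.mpr hW.symm, cubicModulus]
    field_simp
    ring

theorem cubic_transformation_deriv {r : ℝ} (hr : 0 < r) (hr1 : r < 1) :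
    powSum (derivCoeff (hypCoeff (1 / 3) (2 / 3))) (cubicModulus r) *
        (9 * (1 - r) ^ 2 / (1 + 2 * r) ^ 4) =
      2 * powSum (hypCoeff (1 / 3) (2 / 3)) (r ^ 3) + (1 + 2 * r) *
        (powSum (derivCoeff (hypCoeff (1 / 3) (2 / 3))) (r ^ 3) * (3 * r ^ 2)) := by
  have hc : ConvOnUnit (hypCoeff (1 / 3) (2 / 3)) :=
    convOnUnit_hypCoeff (by norm_num) (by norm_num)
  refine (hasDerivAt_powSum_cubicModulus hc hr.le hr1).unique
    ((hasDerivAt_powSum_cube hc hr.le hr1).congr_of_eventuallyEq ?_)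
  filter_upwards [Ioo_mem_nhds hr hr1] with s hs
  exact cubic_transformation hs.1.le hs.2

/-! ### Monotonicity of the defect -/

/-- The difference of the two sides of the cubic transformation with `F` in place of
`F(1/3, 2/3; 1; ·)`. -/
noncomputable def cubicDefect (c : ℕ → ℝ) (r : ℝ) : ℝ :=
  (1 + 2 * r) * powSum c (r ^ 3) - powSum c (cubicModulus r)

theorem hasDerivAt_cubicDefect {c : ℕ → ℝ} (hc : ConvOnUnit c) {r : ℝ} (hr : 0 ≤ r)
    (hr1 : r < 1) : HasDerivAt (cubicDefect c)
      (2 * powSum c (r ^ 3) + (1 + 2 * r) * (powSum (derivCoeff c) (r ^ 3) * (3 * r ^ 2)) -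
        powSum (derivCoeff c) (cubicModulus r) * (9 * (1 - r) ^ 2 / (1 + 2 * r) ^ 4)) r :=
  (hasDerivAt_powSum_cube hc hr hr1).sub (hasDerivAt_powSum_cubicModulus hc hr hr1)

theorem cubicDefect_zero (c : ℕ → ℝ) : cubicDefect c 0 = 0 := by
  simp [cubicDefect, cubicModulus]

/-- The differentiated transformation replaces `3 r² (1 + 2r) H'(r³)` by `X' H'(X) - 2 H(r³)`,
leaving two expressions antisymmetric in `F` and `H`. -/
theorem deriv_cubicDefect_mul {c : ℕ → ℝ} (hc : ConvOnUnit c) {r : ℝ} (hr : 0 < r)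
    (hr1 : r < 1) :
    powSum (derivCoeff (hypCoeff (1 / 3) (2 / 3))) (r ^ 3) * deriv (cubicDefect c) r =
      2 * (powSum c (r ^ 3) * powSum (derivCoeff (hypCoeff (1 / 3) (2 / 3))) (r ^ 3) -
        powSum (derivCoeff c) (r ^ 3) * powSum (hypCoeff (1 / 3) (2 / 3)) (r ^ 3)) +
      9 * (1 - r) ^ 2 / (1 + 2 * r) ^ 4 *
        (powSum (derivCoeff c) (r ^ 3) *
            powSum (derivCoeff (hypCoeff (1 / 3) (2 / 3))) (cubicModulus r) -
          powSum (derivCoeff c) (cubicModulus r) *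
            powSum (derivCoeff (hypCoeff (1 / 3) (2 / 3))) (r ^ 3)) := by
  have h := cubic_transformation_deriv hr hr1
  rw [(hasDerivAt_cubicDefect hc hr.le hr1).deriv]
  linear_combination -powSum (derivCoeff c) (r ^ 3) * h

theorem continuousOn_cubicDefect {c : ℕ → ℝ} (hc : ConvOnUnit c) :
    ContinuousOn (cubicDefect c) (Set.Ico 0 1) := fun _ hx =>
  (hasDerivAt_cubicDefect hc hx.1 hx.2).continuousAt.continuousWithinAt

theorem derivCoeff_third_pos (n : ℕ) : 0 < derivCoeff (hypCoeff (1 / 3) (2 / 3)) n :=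
  mul_pos (by positivity) (hypCoeff_pos (by norm_num) (by norm_num) _)

theorem monotoneOn_cubicDefect {c : ℕ → ℝ} (hc : ConvOnUnit c)
    (h : ∀ m n, m ≤ n → c n * hypCoeff (1 / 3) (2 / 3) m ≤ c m * hypCoeff (1 / 3) (2 / 3) n) :
    MonotoneOn (cubicDefect c) (Set.Ico 0 1) := by
  have hB : ConvOnUnit (hypCoeff (1 / 3) (2 / 3)) :=
    convOnUnit_hypCoeff (by norm_num) (by norm_num)
  refine monotoneOn_of_deriv_nonneg (convex_Ico 0 1) (continuousOn_cubicDefect hc) ?_ ?_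
  · rw [interior_Ico]
    exact fun x hx =>
      (hasDerivAt_cubicDefect hc hx.1.le hx.2).differentiableAt.differentiableWithinAt
  · rw [interior_Ico]
    rintro r ⟨hr, hr1⟩
    have hy := (le_abs_self _).trans_lt (abs_cube_lt_one hr.le hr1)
    have hp := hB.derivCoeff.powSum_pos derivCoeff_third_pos (pow_pos hr 3).le hy
    refine nonneg_of_mul_nonneg_right ?_ hp
    rw [deriv_cubicDefect_mul hc hr hr1]
    have k1 := powSum_derivCoeff_mul_le hc hB h (pow_pos hr 3) hy
    have k2 := powSum_ratio_le hc.derivCoeff hB.derivCoeff (ratio_derivCoeff h) (pow_pos hr 3).le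
      (cube_le_cubicModulus hr.le hr1) (cubicModulus_lt_one hr.le hr1)
    exact add_nonneg (mul_nonneg (by norm_num) (sub_nonneg.mpr k1))
      (mul_nonneg (by positivity) (sub_nonneg.mpr k2))

theorem antitoneOn_cubicDefect {c : ℕ → ℝ} (hc : ConvOnUnit c)
    (h : ∀ m n, m ≤ n → hypCoeff (1 / 3) (2 / 3) n * c m ≤ hypCoeff (1 / 3) (2 / 3) m * c n) :
    AntitoneOn (cubicDefect c) (Set.Ico 0 1) := by
  have hB : ConvOnUnit (hypCoeff (1 / 3) (2 / 3)) :=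
    convOnUnit_hypCoeff (by norm_num) (by norm_num)
  refine antitoneOn_of_deriv_nonpos (convex_Ico 0 1) (continuousOn_cubicDefect hc) ?_ ?_
  · rw [interior_Ico]
    exact fun x hx =>
      (hasDerivAt_cubicDefect hc hx.1.le hx.2).differentiableAt.differentiableWithinAt
  · rw [interior_Ico]
    rintro r ⟨hr, hr1⟩
    have hy := (le_abs_self _).trans_lt (abs_cube_lt_one hr.le hr1)
    have hp := hB.derivCoeff.powSum_pos derivCoeff_third_pos (pow_pos hr 3).le hy
    refine nonpos_of_mul_nonpos_right ?_ hp
    rw [deriv_cubicDefect_mul hc hr hr1]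
    have k1 := powSum_derivCoeff_mul_le hB hc h (pow_pos hr 3) hy
    have k2 := powSum_ratio_le hB.derivCoeff hc.derivCoeff (ratio_derivCoeff h) (pow_pos hr 3).le
      (cube_le_cubicModulus hr.le hr1) (cubicModulus_lt_one hr.le hr1)
    refine add_nonpos (mul_nonpos_of_nonneg_of_nonpos (by norm_num) (by linarith))
      (mul_nonpos_of_nonneg_of_nonpos (by positivity) (by linarith))

/-! ### Digamma and its recurrence -/

theorem differentiableAt_Gamma_of_pos {s : ℝ} (hs : 0 < s) : DifferentiableAt ℝ Real.Gamma s :=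
  Real.differentiableAt_Gamma fun m => by
    have : (0 : ℝ) ≤ m := m.cast_nonneg
    intro h; linarith

theorem hasDerivAt_log_Gamma {s : ℝ} (hs : 0 < s) :
    HasDerivAt (Real.log ∘ Real.Gamma) (realDigamma s) s :=
  (differentiableAt_Gamma_of_pos hs).hasDerivAt.log (Real.Gamma_pos_of_pos hs).ne'

theorem monotoneOn_realDigamma : MonotoneOn realDigamma (Set.Ioi 0) := by
  have h := Real.convexOn_log_Gamma.monotoneOn_deriv
    (fun x hx => (hasDerivAt_log_Gamma hx).differentiableAt)
  exact h.congr fun x hx => (hasDerivAt_log_Gamma hx).deriv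

theorem realDigamma_add_one {s : ℝ} (hs : 0 < s) : realDigamma (s + 1) = realDigamma s + 1 / s := by
  have h1 : HasDerivAt (fun s => Real.Gamma (s + 1)) (deriv Real.Gamma (s + 1)) s := by
    simpa using (differentiableAt_Gamma_of_pos (by positivity : 0 < s + 1)).hasDerivAt.comp_add_const s 1
  have h2 := (hasDerivAt_id s).mul (differentiableAt_Gamma_of_pos hs).hasDerivAt
  have h3 := h1.unique (h2.congr_of_eventuallyEq (by
    filter_upwards [lt_mem_nhds hs] with t ht using Real.Gamma_add_one ht.ne'))
  have := (Real.Gamma_pos_of_pos hs).ne'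
  rw [realDigamma, realDigamma, h3, Real.Gamma_add_one hs.ne']
  simp only [id]
  field_simp
  ring

theorem realDigamma_one : realDigamma 1 = -Real.eulerMascheroniConstant := by
  rw [realDigamma, Real.eulerMascheroniConstant_eq_neg_deriv]; simp

/-- An antitone and a monotone solution of the digamma recurrences cancel up to a constant. -/
theorem add_eq_of_recurrence {f k : ℝ → ℝ} (hf : AntitoneOn f (Set.Ioi 0))
    (hk : MonotoneOn k (Set.Ioi 0)) (hf1 : ∀ s, 0 < s → f (s + 1) = f s - 1 / s)
    (hk1 : ∀ s, 0 < s → k (s + 1) = k s + 1 / s) {s t : ℝ} (hs : 0 < s) (hst : s ≤ t) :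
    f t + k t = f s + k s := by
  have hper : ∀ u, 0 < u → ∀ n : ℕ, f (u + n) + k (u + n) = f u + k u := by
    intro u hu n
    induction n with
    | zero => simp
    | succ n ih =>
      have h : 0 < u + n := by positivity
      push_cast
      rw [← add_assoc, hf1 _ h, hk1 _ h, ← ih]; ring
  have hinc : ∀ u, 0 < u → ∀ M : ℕ, f u - M / u ≤ f (u + M) ∧ k (u + M) ≤ k u + M / u := by
    intro u hu M
    induction M with
    | zero => simp
    | succ M ih =>
      have h : 0 < u + M := by positivity
      have h2 : 1 / (u + M) ≤ 1 / u := one_div_le_one_div_of_le hu (by simp)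
      have h3 : ((M + 1 : ℕ) : ℝ) / u = M / u + 1 / u := by push_cast; ring
      rw [h3]
      push_cast
      rw [← add_assoc, hf1 _ h, hk1 _ h]
      constructor <;> linarith [ih.1, ih.2]
  -- After a shift by `n`, `t + n` lies between `s + n` and `s + n + M`. Monotonicity confines the
  -- changes of `f` and `k` there to at most `M / (s + n)`, while periodicity keeps `f + k`
  -- unchanged by the shift.
  obtain ⟨M, hM⟩ := exists_nat_ge (t - s)
  have ht : 0 < t := hs.trans_le hst
  have hb : ∀ n : ℕ, |f t + k t - (f s + k s)| ≤ M / (s + n) := by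
    intro n
    have hsn : 0 < s + n := by positivity
    have htn : 0 < t + n := by positivity
    have htM : 0 < s + n + M := by positivity
    rw [← hper t ht n, ← hper s hs n, abs_le]
    have a1 := hf (Set.mem_Ioi.mpr hsn) (Set.mem_Ioi.mpr htn) (by linarith)
    have a2 := hf (Set.mem_Ioi.mpr htn) (Set.mem_Ioi.mpr htM) (by linarith)
    have b1 := hk (Set.mem_Ioi.mpr hsn) (Set.mem_Ioi.mpr htn) (by linarith)
    have b2 := hk (Set.mem_Ioi.mpr htn) (Set.mem_Ioi.mpr htM) (by linarith)
    have c := hinc (s + n) hsn M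
    constructor <;> linarith [c.1, c.2]
  have hlim : Tendsto (fun n : ℕ => (M : ℝ) / (s + n)) atTop (𝓝 0) :=
    tendsto_const_nhds.div_atTop
      (tendsto_atTop_add_const_left _ _ tendsto_natCast_atTop_atTop)
  have := ge_of_tendsto' hlim hb
  have := abs_nonpos_iff.mp this
  linarith

/-! ### Gamma quotients and their asymptotics -/

/-- `Γ(a + n) Γ(b + n) / (Γ(a + b + n) n!)`, the coefficients of `B(a, b) F(a, b; a + b; ·)`. -/
noncomputable def gammaCoeff (a b : ℝ) (n : ℕ) : ℝ :=
  Real.Gamma (a + n) * Real.Gamma (b + n) / (Real.Gamma (a + b + n) * n.factorial)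

theorem gammaCoeff_comm (a b : ℝ) (n : ℕ) : gammaCoeff a b n = gammaCoeff b a n := by
  rw [gammaCoeff, gammaCoeff, mul_comm (Real.Gamma (a + n)), add_comm a b]

theorem gammaCoeff_pos {a b : ℝ} (ha : 0 < a) (hb : 0 < b) (n : ℕ) : 0 < gammaCoeff a b n := by
  have h1 : 0 < Real.Gamma (a + n) := Real.Gamma_pos_of_pos (by positivity)
  have h2 : 0 < Real.Gamma (b + n) := Real.Gamma_pos_of_pos (by positivity)
  have h3 : 0 < Real.Gamma (a + b + n) := Real.Gamma_pos_of_pos (by positivity)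
  rw [gammaCoeff]; positivity

theorem gammaCoeff_succ {a b : ℝ} (ha : 0 < a) (hb : 0 < b) (n : ℕ) :
    gammaCoeff a b (n + 1) = gammaCoeff a b n * ((a + n) * (b + n) / ((a + b + n) * (n + 1))) := by
  have h3 : 0 < Real.Gamma (a + b + n) := Real.Gamma_pos_of_pos (by positivity)
  have h4 : (0 : ℝ) < n.factorial := by positivity
  simp only [gammaCoeff, Nat.factorial_succ]
  push_cast
  rw [← add_assoc, ← add_assoc, ← add_assoc, Real.Gamma_add_one (by positivity),
    Real.Gamma_add_one (by positivity), Real.Gamma_add_one (by positivity)]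
  field_simp

theorem gammaCoeff_eq_beta_mul {a b : ℝ} (ha : 0 < a) (hb : 0 < b) (n : ℕ) :
    gammaCoeff a b n = ProbabilityTheory.beta a b * hypCoeff a b n := by
  induction n with
  | zero => simp [gammaCoeff, hypCoeff_zero, ProbabilityTheory.beta]
  | succ n ih => rw [gammaCoeff_succ ha hb, hypCoeff_succ ha hb, ih]; ring

theorem gammaCoeff_one_one (n : ℕ) : gammaCoeff 1 1 n = 1 / (n + 1) := by
  have h : (0 : ℝ) < n.factorial := by positivity
  have e : (1 : ℝ) + 1 + n = ((n + 1 : ℕ) : ℝ) + 1 := by push_cast; ring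
  rw [gammaCoeff, e, Real.Gamma_nat_eq_factorial, add_comm 1 (n : ℝ), Real.Gamma_nat_eq_factorial,
    Nat.factorial_succ]
  push_cast
  field_simp

theorem gammaCoeff_add_one {a b : ℝ} (ha : 0 < a) (hb : 0 < b) (n : ℕ) :
    gammaCoeff (a + 1) b n = gammaCoeff a b n * ((a + n) / (a + b + n)) := by
  have h3 : 0 < Real.Gamma (a + b + n) := Real.Gamma_pos_of_pos (by positivity)
  have h4 : (0 : ℝ) < n.factorial := by positivity
  rw [gammaCoeff, gammaCoeff, show a + 1 + n = a + n + 1 by ring,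
    show a + 1 + b + n = a + b + n + 1 by ring, Real.Gamma_add_one (by positivity),
    Real.Gamma_add_one (by positivity)]
  field_simp

/-- `log Γ(s) - log Γ(s + b)` has derivative `ψ(s) - ψ(s + b) ≤ 0`, by log-convexity of `Γ`. -/
theorem gammaCoeff_antitoneOn {b : ℝ} (hb : 0 < b) (n : ℕ) :
    AntitoneOn (fun a => gammaCoeff a b n) (Set.Ioi 0) := by
  have hlog : AntitoneOn (fun s => Real.log (Real.Gamma s) - Real.log (Real.Gamma (s + b)))
      (Set.Ioi 0) := by
    have hd : ∀ s, 0 < s → HasDerivAt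
        (fun s => Real.log (Real.Gamma s) - Real.log (Real.Gamma (s + b)))
        (realDigamma s - realDigamma (s + b)) s := fun s hs =>
      (hasDerivAt_log_Gamma hs).sub
        ((hasDerivAt_log_Gamma (by positivity : 0 < s + b)).comp_add_const s b)
    refine antitoneOn_of_deriv_nonpos (convex_Ioi 0)
      (fun s hs => (hd s hs).continuousAt.continuousWithinAt) ?_ ?_
    · rw [interior_Ioi]
      exact fun s hs => (hd s hs).differentiableAt.differentiableWithinAt
    · rw [interior_Ioi]
      intro s hs
      have hs' : 0 < s := hs
      rw [(hd s hs).deriv, sub_nonpos]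
      exact monotoneOn_realDigamma hs (Set.mem_Ioi.mpr (by positivity)) (by linarith)
  intro s hs t ht hst
  have hs' : 0 < s := hs
  have ht' : 0 < t := ht
  have h1 := hlog (Set.mem_Ioi.mpr (by positivity : 0 < s + n))
    (Set.mem_Ioi.mpr (by positivity : 0 < t + n)) (by linarith)
  have p : ∀ u : ℝ, 0 < u → 0 < Real.Gamma (u + n) ∧ 0 < Real.Gamma (u + n + b) := fun u hu =>
    ⟨Real.Gamma_pos_of_pos (by positivity), Real.Gamma_pos_of_pos (by positivity)⟩
  have ⟨p1, p2⟩ := p s hs'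
  have ⟨p3, p4⟩ := p t ht'
  have h2 : Real.Gamma (t + n) / Real.Gamma (t + n + b) ≤
      Real.Gamma (s + n) / Real.Gamma (s + n + b) := by
    rw [← Real.log_le_log_iff (by positivity) (by positivity), Real.log_div p3.ne' p4.ne',
      Real.log_div p1.ne' p2.ne']
    exact h1
  have p5 : 0 < Real.Gamma (b + n) := Real.Gamma_pos_of_pos (by positivity)
  have e : ∀ u : ℝ, gammaCoeff u b n =
      Real.Gamma (u + n) / Real.Gamma (u + n + b) * (Real.Gamma (b + n) / n.factorial) := by
    intro u
    rw [gammaCoeff, show u + b + n = u + n + b by ring, div_mul_div_comm]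
  simp only [e]
  gcongr

theorem Gamma_add_natCast_add_one {s : ℝ} (hs : 0 < s) (n : ℕ) :
    Real.Gamma (s + n + 1) = Real.Gamma s * ∏ j ∈ Finset.range (n + 1), (s + j) := by
  induction n with
  | zero => simp [Real.Gamma_add_one hs.ne', mul_comm]
  | succ n ih =>
    rw [Finset.prod_range_succ, ← mul_assoc, ← ih, Real.Gamma_add_one (by positivity)]
    push_cast
    rw [show s + (n + 1) = s + n + 1 by ring]; ring

/-- In Euler's limit formula for `Γ`, the powers of `n` cancel in the quotient for `a + b` over
those for `a` and `b`. -/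
theorem tendsto_succ_mul_gammaCoeff_succ {a b : ℝ} (ha : 0 < a) (hb : 0 < b) :
    Tendsto (fun n : ℕ => ((n : ℝ) + 1) * gammaCoeff a b (n + 1)) atTop (𝓝 1) := by
  have ga := Real.Gamma_pos_of_pos ha
  have gb := Real.Gamma_pos_of_pos hb
  have gab := Real.Gamma_pos_of_pos (add_pos ha hb)
  have hlim := (((Real.GammaSeq_tendsto_Gamma (a + b)).const_mul
    (Real.Gamma a * Real.Gamma b / Real.Gamma (a + b))).div
    ((Real.GammaSeq_tendsto_Gamma a).mul (Real.GammaSeq_tendsto_Gamma b)) (by positivity))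
  have e1 : Real.Gamma a * Real.Gamma b / Real.Gamma (a + b) * Real.Gamma (a + b) /
      (Real.Gamma a * Real.Gamma b) = 1 := by field_simp
  rw [e1] at hlim
  refine hlim.congr' ?_
  filter_upwards [eventually_gt_atTop 0] with n hn
  have hn' : (0 : ℝ) < n := by exact_mod_cast hn
  have q : ∀ s : ℝ, 0 < s → 0 < ∏ j ∈ Finset.range (n + 1), (s + j) := fun s hs =>
    Finset.prod_pos fun j _ => by positivity
  have qa := q a ha
  have qb := q b hb
  have qab := q (a + b) (by positivity)
  have hf : (0 : ℝ) < n.factorial := by positivity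
  have pa := Real.rpow_pos_of_pos hn' a
  have pb := Real.rpow_pos_of_pos hn' b
  simp only [Pi.div_apply, Real.GammaSeq, gammaCoeff, Nat.factorial_succ]
  push_cast
  rw [← add_assoc, ← add_assoc, ← add_assoc, Gamma_add_natCast_add_one ha,
    Gamma_add_natCast_add_one hb, Gamma_add_natCast_add_one (by positivity : 0 < a + b),
    Real.rpow_add hn']
  field_simp

theorem tendsto_mul_gammaCoeff {a b : ℝ} (ha : 0 < a) (hb : 0 < b) :
    Tendsto (fun n : ℕ => (n : ℝ) * gammaCoeff a b n) atTop (𝓝 1) := by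
  rw [← tendsto_add_atTop_iff_nat 1]
  refine (tendsto_succ_mul_gammaCoeff_succ ha hb).congr fun n => ?_
  push_cast; rfl

/-- This exact increment both bounds `n * gammaCoeff a b n` by its limit and telescopes in
`regularizedSum_add_one`. -/
theorem succ_mul_gammaCoeff_sub {a b : ℝ} (ha : 0 < a) (hb : 0 < b) (n : ℕ) :
    ((n + 1 : ℕ) : ℝ) * gammaCoeff a b (n + 1) - n * gammaCoeff a b n =
      a * b * gammaCoeff a b n / (a + b + n) := by
  have : 0 < a + b + n := by positivity
  rw [gammaCoeff_succ ha hb]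
  push_cast
  field_simp
  ring

theorem mul_gammaCoeff_le_one {a b : ℝ} (ha : 0 < a) (hb : 0 < b) (n : ℕ) :
    n * gammaCoeff a b n ≤ 1 := by
  have hm : Monotone fun n : ℕ => (n : ℝ) * gammaCoeff a b n := monotone_nat_of_le_succ fun n => by
    rw [← sub_nonneg, succ_mul_gammaCoeff_sub ha hb]
    have := gammaCoeff_pos ha hb n
    positivity
  exact hm.ge_of_tendsto (tendsto_mul_gammaCoeff ha hb) n

theorem one_sub_le_mul_gammaCoeff {a b : ℝ} (ha : 0 < a) (hb : 0 < b) (n : ℕ) :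
    1 - 2 * (a * b) / (n + 1) ≤ (n + 1) * gammaCoeff a b (n + 1) := by
  -- The increment is at most `ab/(n + 1)²`. The factor `2` lets the correction absorb it, since `n
  -- + 2 ≤ 2(n + 1)`.
  have hm : Antitone fun n : ℕ =>
      ((n : ℝ) + 1) * gammaCoeff a b (n + 1) + 2 * (a * b) / (n + 1) := by
    refine antitone_nat_of_succ_le fun n => ?_
    have h1 := succ_mul_gammaCoeff_sub ha hb (n + 1)
    have h2 := mul_gammaCoeff_le_one ha hb (n + 1)
    push_cast at h1 h2 ⊢
    have h3 : gammaCoeff a b (n + 1) ≤ 1 / (n + 1) := by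
      rw [le_div_iff₀ (by positivity)]; linarith
    have h4 : a * b * gammaCoeff a b (n + 1) / (a + b + (n + 1)) ≤
        a * b * (1 / (n + 1)) / (n + 1) :=
      div_le_div₀ (by positivity) (by gcongr) (by positivity) (by linarith)
    have h5 : a * b * (1 / ((n : ℝ) + 1)) / (n + 1) ≤
        2 * (a * b) / (n + 1) - 2 * (a * b) / (n + 1 + 1) := by
      rw [← sub_nonneg]
      have : 2 * (a * b) / ((n : ℝ) + 1) - 2 * (a * b) / (n + 1 + 1) -
        a * b * (1 / ((n : ℝ) + 1)) / (n + 1) =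
          a * b * n / ((n + 1) ^ 2 * (n + 1 + 1)) := by field_simp; ring
      rw [this]; positivity
    linarith
  have hlim : Tendsto (fun n : ℕ =>
      ((n : ℝ) + 1) * gammaCoeff a b (n + 1) + 2 * (a * b) / (n + 1)) atTop (𝓝 (1 + 0)) :=
    (tendsto_succ_mul_gammaCoeff_succ ha hb).add (tendsto_const_nhds.div_atTop
      (tendsto_atTop_add_const_right _ _ tendsto_natCast_atTop_atTop))
  have := hm.le_of_tendsto hlim n
  linarith

theorem summable_gammaCoeff_sub {a b : ℝ} (ha : 0 < a) (hb : 0 < b) :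
    Summable fun n : ℕ => gammaCoeff a b n - 1 / (n + 1) := by
  rw [← summable_nat_add_iff 1]
  have hs : Summable fun n : ℕ => (2 * (a * b) + 1) * (1 / (((n + 1 : ℕ) : ℝ) ^ 2)) :=
    ((summable_nat_add_iff 1).mpr (Real.summable_one_div_nat_pow.mpr one_lt_two)).mul_left _
  refine Summable.of_norm_bounded hs fun n => ?_
  have h1 := one_sub_le_mul_gammaCoeff ha hb n
  have h2 := mul_gammaCoeff_le_one ha hb (n + 1)
  push_cast at h2 ⊢
  have hn : (0 : ℝ) < n + 1 := by positivity
  have hab := mul_pos ha hb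
  have h3 : gammaCoeff a b (n + 1) ≤ 1 / (n + 1) := by
    rw [le_div_iff₀ hn]; linarith
  have h4 : (1 - 2 * (a * b) / (n + 1)) / (n + 1) ≤ gammaCoeff a b (n + 1) := by
    rw [div_le_iff₀ hn]; linarith
  have h5 : 1 / ((n : ℝ) + 1) - 1 / (n + 1 + 1) ≤ 1 / (n + 1) ^ 2 := by
    rw [← sub_nonneg]
    have : 1 / ((n : ℝ) + 1) ^ 2 - (1 / ((n : ℝ) + 1) - 1 / (n + 1 + 1)) =
      1 / ((n + 1) ^ 2 * (n + 1 + 1)) := by field_simp; ring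
    rw [this]; positivity
  have h6 : 1 / ((n : ℝ) + 1 + 1) ≤ 1 / (n + 1) :=
    one_div_le_one_div_of_le hn (by linarith)
  have h7 : (1 - 2 * (a * b) / ((n : ℝ) + 1)) / (n + 1) =
      1 / (n + 1) - 2 * (a * b) * (1 / (n + 1) ^ 2) := by field_simp
  have h8 : 0 ≤ a * b * (1 / ((n : ℝ) + 1) ^ 2) := by positivity
  have h9 : 0 ≤ 1 / ((n : ℝ) + 1) ^ 2 := by positivity
  rw [Real.norm_eq_abs, abs_le]
  constructor <;> nlinarith

/-! ### The regularized sum and Ramanujan's constant -/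

/-- The regularized sum `∑ (Γ(a + n) Γ(b + n) / (Γ(a + b + n) n!) - 1 / (n + 1))`. -/
noncomputable def regularizedSum (a b : ℝ) : ℝ := ∑' n : ℕ, (gammaCoeff a b n - 1 / (n + 1))

theorem regularizedSum_comm (a b : ℝ) : regularizedSum a b = regularizedSum b a :=
  tsum_congr fun n => by rw [gammaCoeff_comm]

theorem regularizedSum_one_one : regularizedSum 1 1 = 0 := by
  simp [regularizedSum, gammaCoeff_one_one]

theorem regularizedSum_antitoneOn {b : ℝ} (hb : 0 < b) :
    AntitoneOn (fun a => regularizedSum a b) (Set.Ioi 0) := fun _ hs _ ht hst =>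
  (summable_gammaCoeff_sub ht hb).tsum_le_tsum
    (fun n => sub_le_sub_right (gammaCoeff_antitoneOn hb n hs ht hst) _)
    (summable_gammaCoeff_sub hs hb)

/-- Raising `a` by one lowers each term by `1/a` times the increment of `n * gammaCoeff a b n`,
which telescopes to `1`. -/
theorem regularizedSum_add_one {a b : ℝ} (ha : 0 < a) (hb : 0 < b) :
    regularizedSum (a + 1) b = regularizedSum a b - 1 / a := by
  have h1 : HasSum (fun n : ℕ => a * b * gammaCoeff a b n / (a + b + n)) 1 := by
    rw [hasSum_iff_tendsto_nat_of_nonneg]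
    · refine (tendsto_mul_gammaCoeff ha hb).congr fun N => ?_
      simp_rw [← succ_mul_gammaCoeff_sub ha hb]
      rw [Finset.sum_range_sub (fun n : ℕ => (n : ℝ) * gammaCoeff a b n)]
      simp
    · intro n
      have := gammaCoeff_pos ha hb n
      positivity
  have h2 := (summable_gammaCoeff_sub ha hb).hasSum.sub (h1.div_const a)
  refine HasSum.tsum_eq (h2.congr_fun fun n => ?_)
  have : 0 < a + b + n := by positivity
  rw [gammaCoeff_add_one ha hb]
  field_simp
  ring

theorem regularizedSum_add_realDigamma {a b : ℝ} (ha : 0 < a) (hb : 0 < b) :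
    regularizedSum a b + realDigamma a = regularizedSum 1 b + realDigamma 1 := by
  have h : ∀ {s t : ℝ}, 0 < s → s ≤ t →
      regularizedSum t b + realDigamma t = regularizedSum s b + realDigamma s := fun hs hst =>
    add_eq_of_recurrence (regularizedSum_antitoneOn hb) monotoneOn_realDigamma
      (fun _ hs => regularizedSum_add_one hs hb) (fun _ hs => realDigamma_add_one hs) hs hst
  rcases le_total a 1 with h1 | h1
  · exact (h ha h1).symm
  · exact h one_pos h1

/-- Move `a` to `1`, then `b` to `1` by symmetry; the sum vanishes at `(1, 1)` and `ψ(1) = -γ`. -/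
theorem regularizedSum_eq_ramanujanR {a b : ℝ} (ha : 0 < a) (hb : 0 < b) :
    regularizedSum a b = ramanujanR a b := by
  have h1 := regularizedSum_add_realDigamma ha hb
  have h2 := regularizedSum_add_realDigamma hb one_pos
  rw [regularizedSum_one_one, regularizedSum_comm b 1] at h2
  rw [realDigamma_one] at h1 h2
  rw [ramanujanR]
  linarith

/-! ### Behaviour at `1` -/

theorem tendsto_one_sub_mul_log_one_sub :
    Tendsto (fun x : ℝ => (1 - x) * Real.log (1 - x)) (𝓝[<] 1) (𝓝 0) := by
  have h : Continuous fun x : ℝ => (1 - x) * Real.log (1 - x) :=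
    Real.continuous_mul_log.comp (continuous_const.sub continuous_id)
  simpa using (h.tendsto 1).mono_left nhdsWithin_le_nhds

/-- Ramanujan's asymptotic formula for the zero-balanced hypergeometric function at `1`. -/
theorem tendsto_beta_mul_powSum_add_log {a b : ℝ} (ha : 0 < a) (hb : 0 < b) :
    Tendsto (fun x => ProbabilityTheory.beta a b * powSum (hypCoeff a b) x + Real.log (1 - x))
      (𝓝[<] 1) (𝓝 (ramanujanR a b)) := by
  have hs := summable_gammaCoeff_sub ha hb
  have h1 := Real.tendsto_tsum_powerSeries_nhdsWithin_lt hs.hasSum.tendsto_sum_nat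
  change Tendsto _ _ (𝓝 (regularizedSum a b)) at h1
  rw [regularizedSum_eq_ramanujanR ha hb] at h1
  have hid : Tendsto (fun x : ℝ => x) (𝓝[<] 1) (𝓝 1) := tendsto_id.mono_left nhdsWithin_le_nhds
  -- `∑ xⁿ/(n + 1)` is `-log (1 - x)/x`; trading it for `-log (1 - x)` costs `(1 - x) log (1 -
  -- x)/x`, which tends to `0`.
  have h2 := h1.sub (tendsto_one_sub_mul_log_one_sub.div hid one_ne_zero)
  rw [zero_div, sub_zero] at h2
  refine h2.congr' ?_
  filter_upwards [Ioo_mem_nhdsLT (zero_lt_one' ℝ)] with x ⟨hx0, hx1⟩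
  have hx : |x| < 1 := by rwa [abs_of_pos hx0]
  have h3 := ((convOnUnit_hypCoeff ha hb) x hx).hasSum.mul_left (ProbabilityTheory.beta a b)
  have h4 := (Real.hasSum_pow_div_log_of_abs_lt_one hx).div_const x
  have h5 := (h3.sub h4).congr_fun (g := fun n => (gammaCoeff a b n - 1 / (n + 1)) * x ^ n) ?_
  · rw [h5.tsum_eq, Pi.div_apply]
    change ProbabilityTheory.beta a b * powSum (hypCoeff a b) x - _ - _ = _
    field_simp
    ring
  · intro n
    rw [gammaCoeff_eq_beta_mul ha hb]
    field_simp
    ring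

theorem tendsto_cubicDefect {a b : ℝ} (ha : 0 < a) (hb : 0 < b) :
    Tendsto (cubicDefect (hypCoeff a b)) (𝓝[<] 1)
      (𝓝 (2 * (ramanujanR a b - Real.log 27) / ProbabilityTheory.beta a b)) := by
  have hβ := ProbabilityTheory.beta_pos ha hb
  have he := tendsto_beta_mul_powSum_add_log ha hb
  have hIoo : ∀ᶠ r : ℝ in 𝓝[<] 1, r ∈ Set.Ioo (0 : ℝ) 1 := Ioo_mem_nhdsLT zero_lt_one
  have hy : Tendsto (fun r : ℝ => r ^ 3) (𝓝[<] 1) (𝓝[<] 1) := by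
    refine tendsto_nhdsWithin_iff.mpr ⟨?_, ?_⟩
    · have : Continuous fun r : ℝ => r ^ 3 := by fun_prop
      simpa using (this.tendsto 1).mono_left (nhdsWithin_le_nhds (s := Set.Iio 1))
    · filter_upwards [hIoo] with r hr
      exact pow_lt_one₀ hr.1.le hr.2 (by norm_num)
  have hX : Tendsto cubicModulus (𝓝[<] 1) (𝓝[<] 1) := by
    refine tendsto_nhdsWithin_iff.mpr ⟨?_, ?_⟩
    · have h := (hasDerivAt_cubicModulus zero_le_one).continuousAt.tendsto.mono_left
        (nhdsWithin_le_nhds (s := Set.Iio 1))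
      have e : cubicModulus 1 = 1 := by norm_num [cubicModulus]
      rwa [e] at h
    · filter_upwards [hIoo] with r hr
      exact cubicModulus_lt_one hr.1.le hr.2
  have hm : Tendsto (fun r : ℝ => 1 + 2 * r) (𝓝[<] 1) (𝓝 3) := by
    have : Continuous fun r : ℝ => 1 + 2 * r := by fun_prop
    convert! (this.tendsto 1).mono_left (nhdsWithin_le_nhds (s := Set.Iio 1)) using 2
    norm_num
  have hq : Tendsto (fun r : ℝ => 1 + r + r ^ 2) (𝓝[<] 1) (𝓝 3) := by
    have : Continuous fun r : ℝ => 1 + r + r ^ 2 := by fun_prop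
    convert! (this.tendsto 1).mono_left (nhdsWithin_le_nhds (s := Set.Iio 1)) using 2
    norm_num
  -- The `log (1 - r)` terms combine to `2(1 - r) log (1 - r) → 0`. The factors `1 + r + r²` and `1
  -- + 2r`, both tending to `3`, each contribute `3 log 3`, together `2 log 27`.
  have h := (((((hm.mul (he.comp hy)).sub (he.comp hX)).add
    (tendsto_one_sub_mul_log_one_sub.const_mul 2)).sub
      (hm.mul (hq.log (by norm_num)))).sub ((hm.log (by norm_num)).const_mul 3)).div_const
        (ProbabilityTheory.beta a b)
  have e27 : Real.log 27 = 3 * Real.log 3 := by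
    rw [show (27 : ℝ) = 3 ^ 3 by norm_num, Real.log_pow]; norm_num
  have e : 3 * ramanujanR a b - ramanujanR a b + 2 * 0 - 3 * Real.log 3 - 3 * Real.log 3 =
      2 * (ramanujanR a b - Real.log 27) := by rw [e27]; ring
  rw [e] at h
  refine h.congr' ?_
  filter_upwards [hIoo] with r hr
  have h1 : 0 < 1 - r := by linarith [hr.2]
  have hr0 := hr.1
  have h2 : 0 < 1 + 2 * r := by positivity
  have h3 : 0 < 1 + r + r ^ 2 := by positivity
  have l1 : Real.log (1 - r ^ 3) = Real.log (1 - r) + Real.log (1 + r + r ^ 2) := by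
    rw [← Real.log_mul h1.ne' h3.ne']; congr 1; ring
  have l2 : Real.log (1 - cubicModulus r) = 3 * (Real.log (1 - r) - Real.log (1 + 2 * r)) := by
    rw [one_sub_cubicModulus hr0.le, Real.log_pow, Real.log_div h1.ne' h2.ne']; norm_num
  simp only [Function.comp_apply, l1, l2, cubicDefect]
  rw [div_eq_iff hβ.ne']
  ring

/-! ### Coefficient comparison and conclusion -/

theorem hypCoeff_ratio_le {a b c d : ℝ} (ha : 0 < a) (hb : 0 < b) (hc : 0 < c) (hd : 0 < d)
    (h : ∀ n : ℕ, (a + n) * (b + n) * (c + d + n) ≤ (c + n) * (d + n) * (a + b + n)) (m n : ℕ)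
    (hmn : m ≤ n) : hypCoeff a b n * hypCoeff c d m ≤ hypCoeff a b m * hypCoeff c d n := by
  refine ratio_le_of_succ (hypCoeff_pos hc hd) (fun n => ?_) m n hmn
  have p1 := hypCoeff_pos ha hb n
  have p2 := hypCoeff_pos hc hd n
  rw [hypCoeff_succ ha hb, hypCoeff_succ hc hd]
  have key : (a + n) * (b + n) / ((a + b + n) * (n + 1)) ≤
      (c + n) * (d + n) / ((c + d + n) * (n + 1)) := by
    rw [div_le_div_iff₀ (by positivity) (by positivity)]
    have := mul_le_mul_of_nonneg_right (h n) (by positivity : (0 : ℝ) ≤ n + 1)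
    linarith
  have := mul_le_mul_of_nonneg_left key (mul_pos p1 p2).le
  linarith

theorem mem_Icc_of_monotoneOn_Ico {g : ℝ → ℝ} {l : ℝ} (hg : MonotoneOn g (Set.Ico 0 1))
    (h0 : g 0 = 0) (hl : Tendsto g (𝓝[<] 1) (𝓝 l)) {r : ℝ} (hr : r ∈ Set.Ioo (0 : ℝ) 1) :
    0 ≤ g r ∧ g r ≤ l := by
  constructor
  · rw [← h0]
    exact hg ⟨le_rfl, one_pos⟩ ⟨hr.1.le, hr.2⟩ hr.1.le
  · refine ge_of_tendsto hl ?_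
    filter_upwards [Ioo_mem_nhdsLT hr.2] with s hs
    exact hg ⟨hr.1.le, hr.2⟩ ⟨(hr.1.trans hs.1).le, hs.2⟩ hs.1.le

theorem theorem2p4 :
    (∀ a b : ℝ, (a, b) ∈ regionD5 → ∀ r : ℝ, r ∈ Set.Ioo (0 : ℝ) 1 →
      0 ≤ (1 + 2 * r) * zeroBalancedF a b (r ^ 3)
          - zeroBalancedF a b (9 * r * (1 + r + r ^ 2) / (1 + 2 * r) ^ 3) ∧
      (1 + 2 * r) * zeroBalancedF a b (r ^ 3)
          - zeroBalancedF a b (9 * r * (1 + r + r ^ 2) / (1 + 2 * r) ^ 3)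
        ≤ 2 * (ramanujanR a b - Real.log 27) / ProbabilityTheory.beta a b) ∧
    (∀ a b : ℝ, (a, b) ∈ regionD6 → ∀ r : ℝ, r ∈ Set.Ioo (0 : ℝ) 1 →
      0 ≤ zeroBalancedF a b (9 * r * (1 + r + r ^ 2) / (1 + 2 * r) ^ 3)
          - (1 + 2 * r) * zeroBalancedF a b (r ^ 3) ∧
      zeroBalancedF a b (9 * r * (1 + r + r ^ 2) / (1 + 2 * r) ^ 3)
          - (1 + 2 * r) * zeroBalancedF a b (r ^ 3)
        ≤ 2 * (Real.log 27 - ramanujanR a b) / ProbabilityTheory.beta a b) := by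
  refine ⟨fun a b hab r hr => ?_, fun a b hab r hr => ?_⟩
  · obtain ⟨ha, hb, hs, hp⟩ := hab
    simp only at ha hb hs hp
    simp only [zeroBalancedF_eq_powSum]
    refine mem_Icc_of_monotoneOn_Ico (monotoneOn_cubicDefect (convOnUnit_hypCoeff ha hb)
      (hypCoeff_ratio_le ha hb (by norm_num) (by norm_num) fun n => ?_)) (cubicDefect_zero _)
      (tendsto_cubicDefect ha hb) hr
    -- Right side minus left side is `(2/9 - ab) n + (2/9 (a + b) - ab)`. The constant term is
    -- nonnegative by the region, and `a + b ≤ 1` then gives `ab ≤ 2/9`.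
    have hn : (0 : ℝ) ≤ n := n.cast_nonneg
    have h1 : a * b - 2 / 9 ≤ 0 := by linarith
    nlinarith [mul_nonneg hn (neg_nonneg.mpr h1)]
  · obtain ⟨ha, hb, hs, hp⟩ := hab
    simp only at ha hb hs hp
    simp only [zeroBalancedF_eq_powSum]
    have hlim := (tendsto_cubicDefect ha hb).neg
    have hmono := (antitoneOn_cubicDefect (convOnUnit_hypCoeff ha hb)
      (hypCoeff_ratio_le (by norm_num) (by norm_num) ha hb fun n => ?_)).neg
    · have := mem_Icc_of_monotoneOn_Ico hmono (by simp [cubicDefect_zero]) hlim hr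
      rw [← neg_div, ← mul_neg, neg_sub, cubicDefect, neg_sub] at this
      exact this
    · have hn : (0 : ℝ) ≤ n := n.cast_nonneg
      have h1 : 0 ≤ a * b - 2 / 9 := by linarith
      nlinarith [mul_nonneg hn h1]
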